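/- Let $X=(X_1,X_2,\dots)$ be an infinite sequence of random variables, $X_i$ with values in a measurable space whose $\sigma$-algebra is countably generated (for instance a subset of $\mathbb{R}^m$), and let $P$ and $Q$ be two probability distributions for $X$. Write $P^n,Q^n$ for the joint distributions of $(X_1,\dots,X_n)$, and let $P_i,Q_i$ be (versions of the regular) conditional distributions of $X_i$ given $X_1=x_1,\dots,X_{i-1}=x_{i-1}$ under $P$ and $Q$; they depend on $(x_1,\dots,x_{i-1})$. Assume $P^n\ll Q^n$ for every $n$ (so that the $Q_i$ are determined $P$-almost surely). For each $i$ let $S_i$ be a proper scoring rule for $X_i$, which may depend on $(x_1,\dots,x_{i-1})$: on a class of distributions that $P$-almost surely contains $P_i$ and $Q_i$, the expected score $S_i(R,R')=\mathbb{E}_{Y\sim R}\,S_i(Y,R')$ exists in $(-\infty,+\infty]$, $S_i(R,R)$ is finite, and $S_i(R,R)\le S_i(R,R')$. Let $D_i(R,R')=S_i(R,R')-S_i(R,R)$ be the associated discrepancy, and let $$D^n=\sum_{i=1}^n D_i(P_i,Q_i)\in[0,\infty].$$ Let $H$ denote the Hellinger distance, $H^2(R,R')=\frac12\int(\sqrt{r}-\sqrt{r'})^2\,d\mu$,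 where $r,r'$ are the densities of $R,R'$ with respect to a dominating measure $\mu$. Suppose that $P$ and $Q$ are mutually singular as distributions of the infinite sequence $X$, and that there is a constant $k>0$ such that, for all $i$, $D_i(P_i,Q_i)\ge k\,H^2(P_i,Q_i)$ $P$-almost surely. Then $D^n\to\infty$ $P$-almost surely. -/

import Mathlib

open MeasureTheory ProbabilityTheory Filter Topology
open scoped ENNReal

noncomputable section

/-- The Hellinger distance `H(P, Q)`, with `H² = ½ ∫ (√p - √q)² dμ`, where `p`, `q` are the
densities of `P`, `Q` with respect to the dominating measure `μ = P + Q`. -/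
def hellingerDist {E : Type*} [MeasurableSpace E] (P Q : Measure E) : ℝ :=
  √(2⁻¹ * ∫ x, (√(P.rnDeriv (P + Q) x).toReal - √(Q.rnDeriv (P + Q) x).toReal) ^ 2 ∂(P + Q))

/-- The expectation `E_P f` of an extended-real function, as the expectation of the positive part
minus that of the negative part (meaningful when one of them is finite). -/
def extExpectation {E : Type*} [MeasurableSpace E] (P : Measure E) (f : E → EReal) : EReal :=
  ((∫⁻ x, (f x).toENNReal ∂P : ℝ≥0∞) : EReal) - ((∫⁻ x, (-f x).toENNReal ∂P : ℝ≥0∞) : EReal)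

/-- A proper scoring rule on a sample space `E`, for a class `dom` of probability distributions:
the expected scores `S(P, Q) = E_{X ∼ P} S(X, Q)` exist in `(-∞, +∞]`, the entropies `S(P, P)` are
finite, and `S(P, Q)` is minimised over `Q` at `Q = P`. -/
structure ProperScoringRule (E : Type*) [MeasurableSpace E] where
  /-- the distributions that may be quoted -/
  dom : Set (Measure E)
  /-- the score `S(x, Q)` -/
  score : E → Measure E → EReal
  isProbabilityMeasure : ∀ P ∈ dom, IsProbabilityMeasure P
  aemeasurable : ∀ P ∈ dom, ∀ Q ∈ dom, AEMeasurable (fun x => score x Q) P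
  neg_part_finite : ∀ P ∈ dom, ∀ Q ∈ dom, ∫⁻ x, (-score x Q).toENNReal ∂P ≠ ∞
  entropy_finite : ∀ P ∈ dom, extExpectation P (fun x => score x P) ≠ ⊤
  proper : ∀ P ∈ dom, ∀ Q ∈ dom,
    extExpectation P (fun x => score x P) ≤ extExpectation P (fun x => score x Q)

namespace ProperScoringRule

variable {E : Type*} [MeasurableSpace E]

/-- The expected score `S(P, Q)`. -/
def expectedScore (S : ProperScoringRule E) (P Q : Measure E) : EReal :=
  extExpectation P (fun x => S.score x Q)

/-- The generalised entropy `H(P) = S(P, P)`. -/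
def entropy (S : ProperScoringRule E) (P : Measure E) : EReal :=
  S.expectedScore P P

/-- The discrepancy `D(P, Q) = S(P, Q) - H(P)`. -/
def discrepancy (S : ProperScoringRule E) (P Q : Measure E) : EReal :=
  S.expectedScore P Q - S.entropy P

end ProperScoringRule

/-- The histories of length `n`: the values of the first `n` terms `x 0, …, x (n - 1)`. -/
abbrev History (E : ℕ → Type*) (n : ℕ) : Type _ := (i : Finset.range n) → E i

/-- The first `n` terms of an infinite sequence. -/
def past {E : ℕ → Type*} (n : ℕ) (x : (i : ℕ) → E i) : History E n := fun i => x i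

/-- The joint distribution `P^n` of the first `n` terms. -/
def jointLaw {E : ℕ → Type*} [∀ i, MeasurableSpace (E i)] (P : Measure ((i : ℕ) → E i)) (n : ℕ) :
    Measure (History E n) :=
  P.map (past n)

/-- `p` is a version of the sequence of recursive conditional distributions of `P`: for every `n`,
`p n h` is a regular conditional distribution of the term `x n` given that the terms before it
are `h`. -/
def IsPredictive {E : ℕ → Type*} [∀ i, MeasurableSpace (E i)] (P : Measure ((i : ℕ) → E i))
    (p : (n : ℕ) → Kernel (History E n) (E n)) : Prop :=
  ∀ n, (jointLaw P n).compProd (p n) = P.map (fun x => (past n x, x n))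

/-- The cumulative discrepancy `D^n`: the sum over the first `n` terms of the discrepancies
between the conditional distributions, for component scoring rules that may depend on the past. -/
def cumulativeDiscrepancy {E : ℕ → Type*} [∀ i, MeasurableSpace (E i)]
    (S : (n : ℕ) → History E n → ProperScoringRule (E n))
    (p q : (n : ℕ) → Kernel (History E n) (E n)) (n : ℕ) (x : (i : ℕ) → E i) : EReal :=
  ∑ i ∈ Finset.range n, (S i (past i x)).discrepancy (p i (past i x)) (q i (past i x))

end

/-! Singularity forces the predictive squared Hellinger distances `h_i` to have an infinite sum
`P`-a.s. (`ae_tsum_condHellingerSq_eq_top`); the bound `D_i ≥ k h_i` then finishes the proof.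

Let `Z_n` be the likelihood ratio of the first `n` terms. Since `h_i` depends only on the past, the
event `B_n` that `∑_{m ≤ i < n} h_i ≤ c` is known one step ahead, and integrating out one term at a
time gives `∫_{B_n} (√Z_n - √Z_m)² dQ ≤ 2c` (`lintegral_smallVariation_le`). With `c = t²` this
makes `P` on `B_n` at most `Z_m · Q` plus an error `4t` (`measure_inter_smallVariation_le`). But
`Z_m · Q ≪ Q` is singular to `P`, so testing on a cylinder that nearly separates the two shows `P(⋂
B_n) ≤ 6t` (`measure_iInter_smallVariation_le`). A convergent sum has a tail at most `t²`, so
convergence has probability at most `6t` for every `t > 0`. -/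

theorem measurable_past {E : ℕ → Type*} [∀ i, MeasurableSpace (E i)] (n : ℕ) :
    Measurable (past (E := E) n) :=
  measurable_pi_lambda _ fun _ => measurable_pi_apply _

/-- The σ-algebra generated by the first `n` terms. -/
abbrev pastAlgebra (E : ℕ → Type*) [∀ i, MeasurableSpace (E i)] (n : ℕ) :
    MeasurableSpace ((i : ℕ) → E i) :=
  MeasurableSpace.comap (past n) inferInstance

/-! ### Filtration of the past and disintegration of the next term -/

section Past

variable {E : ℕ → Type*} [∀ i, MeasurableSpace (E i)]

theorem pastAlgebra_le (n : ℕ) : pastAlgebra E n ≤ MeasurableSpace.pi :=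
  (measurable_past n).comap_le

theorem measurable_apply_pastAlgebra {i n : ℕ} (h : i < n) :
    Measurable[pastAlgebra E n] (fun x : (i : ℕ) → E i => x i) :=
  (measurable_pi_apply (⟨i, Finset.mem_range.2 h⟩ : Finset.range n)).comp
    (comap_measurable (past n))

theorem measurable_past_pastAlgebra {m n : ℕ} (h : m ≤ n) :
    Measurable[pastAlgebra E n] (past (E := E) m) :=
  @measurable_pi_lambda _ _ _ (pastAlgebra E n) _ _ fun i =>
    measurable_apply_pastAlgebra ((Finset.mem_range.1 i.2).trans_le h)

theorem pastAlgebra_mono {m n : ℕ} (h : m ≤ n) : pastAlgebra E m ≤ pastAlgebra E n :=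
  (measurable_past_pastAlgebra h).comap_le

/-- A function of the first `n + 1` terms is a function of the first `n` terms and the next one. -/
theorem exists_eq_comp_past_next {n : ℕ} {f : ((i : ℕ) → E i) → ℝ≥0∞}
    (hf : Measurable[pastAlgebra E (n + 1)] f) :
    ∃ g : History E n × E n → ℝ≥0∞, Measurable g ∧ ∀ x, f x = g (past n x, x n) := by
  have hle : pastAlgebra E (n + 1) ≤ MeasurableSpace.comap
      (fun x : (i : ℕ) → E i => (past n x, x n)) inferInstance := by
    refine Measurable.comap_le ?_
    refine @measurable_pi_lambda _ _ _ (MeasurableSpace.comap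
      (fun x : (i : ℕ) → E i => (past n x, x n)) inferInstance) _ _ fun i => ?_
    obtain ⟨i, hi⟩ := i
    rcases (Nat.lt_succ_iff_lt_or_eq.1 (Finset.mem_range.1 hi)) with h | rfl
    · exact ((measurable_pi_apply (⟨i, Finset.mem_range.2 h⟩ : Finset.range n)).comp
        measurable_fst).comp (comap_measurable (fun x : (i : ℕ) → E i => (past n x, x n)))
    · exact measurable_snd.comp (comap_measurable (fun x : (j : ℕ) → E j => (past i x, x i)))
  obtain ⟨g, hg, h⟩ := (hf.mono hle le_rfl).exists_eq_measurable_comp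
  exact ⟨g, hg, fun x => congrFun h x⟩

theorem IsPredictive.lintegral_next {P : Measure ((i : ℕ) → E i)} [IsProbabilityMeasure P]
    {p : (n : ℕ) → Kernel (History E n) (E n)} [∀ n, IsMarkovKernel (p n)]
    (hp : IsPredictive P p) (n : ℕ) {g : History E n × E n → ℝ≥0∞} (hg : Measurable g) :
    ∫⁻ x, g (past n x, x n) ∂P = ∫⁻ x, ∫⁻ y, g (past n x, y) ∂(p n (past n x)) ∂P := by
  have : IsProbabilityMeasure (jointLaw P n) :=
    Measure.isProbabilityMeasure_map (measurable_past n).aemeasurable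
  rw [← lintegral_map (f := g) (g := fun x => (past n x, x n)) hg
    ((measurable_past n).prodMk (measurable_pi_apply n)), ← hp n,
    Measure.lintegral_compProd hg, jointLaw,
    lintegral_map hg.lintegral_kernel_prod_right' (measurable_past n)]

/-- Absolute continuity of the laws of the first `n + 1` terms passes to the kernels almost
everywhere; countable generation of the σ-algebras enters here. -/
theorem ae_absolutelyContinuous_predictive {P Q : Measure ((i : ℕ) → E i)}
    [IsProbabilityMeasure P] [IsProbabilityMeasure Q]
    [∀ i, MeasurableSpace.CountablyGenerated (E i)]
    {p q : (n : ℕ) → Kernel (History E n) (E n)}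
    [∀ n, IsMarkovKernel (p n)] [∀ n, IsMarkovKernel (q n)]
    (hp : IsPredictive P p) (hq : IsPredictive Q q)
    (hac : ∀ n, jointLaw P n ≪ jointLaw Q n) (n : ℕ) :
    ∀ᵐ x ∂P, p n (past n x) ≪ q n (past n x) := by
  have : IsProbabilityMeasure (jointLaw P n) :=
    Measure.isProbabilityMeasure_map (measurable_past n).aemeasurable
  have : IsProbabilityMeasure (jointLaw Q n) :=
    Measure.isProbabilityMeasure_map (measurable_past n).aemeasurable
  let φ : History E (n + 1) → History E n × E n := fun h =>
    (fun i => h ⟨i, Finset.mem_range.2 ((Finset.mem_range.1 i.2).trans n.lt_succ_self)⟩,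
      h ⟨n, Finset.self_mem_range_succ n⟩)
  have hφ : Measurable φ :=
    (measurable_pi_lambda _ fun i => measurable_pi_apply _).prodMk (measurable_pi_apply _)
  have key : (jointLaw P n).compProd (p n) ≪ (jointLaw Q n).compProd (q n) := by
    have h := (hac (n + 1)).map hφ
    rw [jointLaw, jointLaw, Measure.map_map hφ (measurable_past _),
      Measure.map_map hφ (measurable_past _)] at h
    rw [hp n, hq n]
    exact h
  exact ae_of_ae_map (measurable_past n).aemeasurable key.kernel_of_compProd

end Past

/-! ### Likelihood ratios and their link with the Hellinger distance -/

section Likelihood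

variable {E : ℕ → Type*} [∀ i, MeasurableSpace (E i)]
  [∀ i, MeasurableSpace.CountablyGenerated (E i)]

noncomputable section

/-- The likelihood ratio of the next term, given the history. -/
def condRatio (p q : (n : ℕ) → Kernel (History E n) (E n)) (n : ℕ) (z : History E n × E n) : ℝ :=
  ((p n).rnDeriv (q n) z.1 z.2).toReal

/-- The likelihood ratio of the first `n` terms. -/
def pastRatio (p q : (n : ℕ) → Kernel (History E n) (E n)) (n : ℕ) (x : (i : ℕ) → E i) : ℝ :=
  ∏ i ∈ Finset.range n, condRatio p q i (past i x, x i)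

/-- The squared Hellinger distance of the conditional distributions of the next term, computed
from the likelihood ratio. -/
def condHellingerSq (p q : (n : ℕ) → Kernel (History E n) (E n)) (n : ℕ) (h : History E n) :
    ℝ≥0∞ :=
  2⁻¹ * ∫⁻ y, ENNReal.ofReal ((√(condRatio p q n (h, y)) - 1) ^ 2) ∂(q n h)

end

variable (p q : (n : ℕ) → Kernel (History E n) (E n))

theorem condRatio_nonneg (n : ℕ) (z : History E n × E n) : 0 ≤ condRatio p q n z :=
  ENNReal.toReal_nonneg

theorem pastRatio_nonneg (n : ℕ) (x : (i : ℕ) → E i) : 0 ≤ pastRatio p q n x :=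
  Finset.prod_nonneg fun _ _ => condRatio_nonneg _ _ _ _

theorem pastRatio_succ (n : ℕ) (x : (i : ℕ) → E i) :
    pastRatio p q (n + 1) x = pastRatio p q n x * condRatio p q n (past n x, x n) :=
  Finset.prod_range_succ _ _

theorem measurable_condRatio (n : ℕ) : Measurable (condRatio p q n) :=
  (Kernel.measurable_rnDeriv (p n) (q n)).ennreal_toReal

theorem measurable_pastRatio (n : ℕ) : Measurable[pastAlgebra E n] (pastRatio p q n) := by
  refine Finset.measurable_fun_prod _ fun i hi => (measurable_condRatio p q i).comp ?_
  exact (measurable_past_pastAlgebra (Finset.mem_range.1 hi).le).prodMk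
    (measurable_apply_pastAlgebra (Finset.mem_range.1 hi))

theorem measurable_condHellingerSq [∀ n, IsMarkovKernel (q n)] (n : ℕ) :
    Measurable (condHellingerSq p q n) := by
  refine Measurable.const_mul (Measurable.lintegral_kernel_prod_right' (κ := q n)
    (f := fun z => ENNReal.ofReal ((√(condRatio p q n z) - 1) ^ 2)) ?_) _
  exact (((measurable_condRatio p q n).sqrt.sub_const 1).pow_const 2).ennreal_ofReal

variable [∀ n, IsMarkovKernel (p n)] [∀ n, IsMarkovKernel (q n)]

theorem lintegral_condRatio_mul {n : ℕ} {h : History E n} (hpq : p n h ≪ q n h)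
    {f : E n → ℝ≥0∞} (hf : Measurable f) :
    ∫⁻ y, ENNReal.ofReal (condRatio p q n (h, y)) * f y ∂(q n h) = ∫⁻ y, f y ∂(p n h) := by
  rw [← lintegral_rnDeriv_mul hpq hf.aemeasurable]
  refine lintegral_congr_ae ?_
  filter_upwards [Kernel.rnDeriv_eq_rnDeriv_measure (κ := p n) (η := q n) (a := h),
    (p n h).rnDeriv_ne_top (q n h)] with y h1 h2
  rw [condRatio, h1, ENNReal.ofReal_toReal h2]

/-- The likelihood ratio of the first `n` terms is a density of `P` on the events they determine. -/
theorem lintegral_eq_lintegral_mul_pastRatio {P Q : Measure ((i : ℕ) → E i)}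
    [IsProbabilityMeasure P] [IsProbabilityMeasure Q]
    (hp : IsPredictive P p) (hq : IsPredictive Q q)
    (hpq : ∀ n, ∀ᵐ x ∂P, p n (past n x) ≪ q n (past n x)) (n : ℕ) :
    ∀ {f : ((i : ℕ) → E i) → ℝ≥0∞}, Measurable[pastAlgebra E n] f →
      ∫⁻ x, f x ∂P = ∫⁻ x, f x * ENNReal.ofReal (pastRatio p q n x) ∂Q := by
  induction n with
  | zero =>
    intro f hf
    -- The empty history carries no information, so `f` is constant.
    have hc : ∀ x y, f x = f y := fun x y => by
      obtain ⟨g, -, rfl⟩ := hf.exists_eq_measurable_comp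
      exact congrArg g (funext fun i => absurd i.2 (by simp))
    obtain ⟨x₀⟩ : Nonempty ((i : ℕ) → E i) := P.nonempty_of_neZero
    simp [pastRatio, hc _ x₀]
  | succ n ih =>
    intro f hf
    obtain ⟨g, hg, hfg⟩ := exists_eq_comp_past_next hf
    have hr := (measurable_condRatio p q n).ennreal_ofReal
    obtain ⟨z, hz, hZ⟩ := (measurable_pastRatio p q n).exists_eq_measurable_comp
    have h1 := ih (f := fun x => ∫⁻ y, ENNReal.ofReal (condRatio p q n (past n x, y)) *
      g (past n x, y) ∂(q n (past n x)))
      ((hr.mul hg).lintegral_kernel_prod_right'.comp (comap_measurable (past n)))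
    have h2 := hq.lintegral_next n (g := fun w => ENNReal.ofReal (condRatio p q n w) * g w *
      ENNReal.ofReal (z w.1)) ((hr.mul hg).mul (hz.comp measurable_fst).ennreal_ofReal)
    simp only [hfg]
    rw [hp.lintegral_next n hg]
    -- The kernels are exchanged while the outer measure is still `P`, because absolute continuity
    -- is only known `P`-a.e.
    trans ∫⁻ x, ∫⁻ y, ENNReal.ofReal (condRatio p q n (past n x, y)) *
      g (past n x, y) ∂(q n (past n x)) ∂P
    · refine lintegral_congr_ae ?_
      filter_upwards [hpq n] with x hx
      exact (lintegral_condRatio_mul p q hx (hg.comp measurable_prodMk_left)).symm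
    rw [h1]
    trans ∫⁻ x, ENNReal.ofReal (condRatio p q n (past n x, x n)) * g (past n x, x n) *
      ENNReal.ofReal (z (past n x)) ∂Q
    · rw [h2]
      refine lintegral_congr fun x => ?_
      rw [hZ]
      exact (lintegral_mul_const (ENNReal.ofReal (z (past n x)))
        ((hr.mul hg).comp measurable_prodMk_left)).symm
    · refine lintegral_congr fun x => ?_
      rw [pastRatio_succ, ENNReal.ofReal_mul (pastRatio_nonneg _ _ _ _), hZ, Function.comp]
      ring

/-- On histories with absolutely continuous conditional distributions, `condHellingerSq` is the
squared Hellinger distance. -/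
theorem condHellingerSq_eq {n : ℕ} {h : History E n} (hpq : p n h ≪ q n h) :
    condHellingerSq p q n h = ENNReal.ofReal (hellingerDist (p n h) (q n h) ^ 2) := by
  set μ := p n h
  set ν := q n h
  have hνρ : ν ≪ μ + ν := Measure.absolutelyContinuous_of_le (Measure.le_add_left le_rfl)
  rw [hellingerDist, Real.sq_sqrt (mul_nonneg (by norm_num)
    (integral_nonneg fun _ => sq_nonneg _)), ENNReal.ofReal_mul (by norm_num),
    ENNReal.ofReal_inv_of_pos two_pos, ENNReal.ofReal_ofNat, condHellingerSq]
  congr 1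
  have hm : Measurable fun x => ENNReal.ofReal ((√(condRatio p q n (h, x)) - 1) ^ 2) :=
    ((((measurable_condRatio p q n).comp measurable_prodMk_left).sqrt.sub_const
      1).pow_const 2).ennreal_ofReal
  -- Chain rule `dμ/d(μ+ν) = dμ/dν · dν/d(μ+ν)`; where the last factor vanishes both sides are zero.
  have hae : (fun x => ν.rnDeriv (μ + ν) x * ENNReal.ofReal ((√(condRatio p q n (h, x)) - 1) ^ 2))
      =ᵐ[μ + ν] fun x => ENNReal.ofReal
        ((√(μ.rnDeriv (μ + ν) x).toReal - √(ν.rnDeriv (μ + ν) x).toReal) ^ 2) := by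
    have h1 : ∀ᵐ x ∂(μ + ν), ν.rnDeriv (μ + ν) x ≠ 0 →
        condRatio p q n (h, x) = (μ.rnDeriv ν x).toReal := by
      have := Kernel.rnDeriv_eq_rnDeriv_measure (κ := p n) (η := q n) (a := h)
      change _ =ᵐ[ν] _ at this
      rw [← Measure.withDensity_rnDeriv_eq ν (μ + ν) hνρ] at this
      have := (ae_withDensity_iff (Measure.measurable_rnDeriv _ _)).1 this
      filter_upwards [this] with x hx h0
      rw [condRatio, hx h0]
    filter_upwards [h1, Measure.rnDeriv_mul_rnDeriv (κ := μ + ν) hpq,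
      ν.rnDeriv_ne_top (μ + ν)] with x h1 h2 h3
    rw [← h2, Pi.mul_apply, ENNReal.toReal_mul]
    by_cases h0 : ν.rnDeriv (μ + ν) x = 0
    · simp [h0]
    rw [h1 h0, Real.sqrt_mul ENNReal.toReal_nonneg, ← sub_one_mul, mul_pow,
      Real.sq_sqrt ENNReal.toReal_nonneg, mul_comm, ENNReal.ofReal_mul (sq_nonneg _),
      ENNReal.ofReal_toReal h3]
  rw [integral_eq_lintegral_of_nonneg_ae (ae_of_all _ fun _ => sq_nonneg _) (by fun_prop),
    ← lintegral_congr_ae hae, lintegral_rnDeriv_mul hνρ hm.aemeasurable, ENNReal.ofReal_toReal]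
  -- Finiteness from `(√r - 1)² ≤ r + 1`, whose integral is 2.
  refine ne_top_of_le_ne_top (b := ∫⁻ y, ENNReal.ofReal (condRatio p q n (h, y)) * 1 + 1 ∂ν) ?_
    (lintegral_mono fun y => ?_)
  · rw [lintegral_add_right _ measurable_const,
      lintegral_condRatio_mul p q hpq measurable_const]
    simp
  · have hr := condRatio_nonneg p q n (h, y)
    rw [mul_one, ← ENNReal.ofReal_one, ← ENNReal.ofReal_add hr zero_le_one]
    refine ENNReal.ofReal_le_ofReal ?_
    nlinarith [Real.sq_sqrt hr, Real.sqrt_nonneg (condRatio p q n (h, y))]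

end Likelihood

/-! ### Hellinger increments of the likelihood ratio -/

theorem mul_sqrt_sub_sq_add (u w s : ℝ) :
    (u * s - w) ^ 2 + u * w * (s ^ 2 + 1) = u ^ 2 * s ^ 2 + w ^ 2 + u * w * (s - 1) ^ 2 := by
  ring

section Hellinger

variable {E : ℕ → Type*} [∀ i, MeasurableSpace (E i)]
  [∀ i, MeasurableSpace.CountablyGenerated (E i)]
  (p q : (n : ℕ) → Kernel (History E n) (E n))
  [∀ n, IsMarkovKernel (p n)] [∀ n, IsMarkovKernel (q n)]

/-- The Hellinger-type increment for one further term. -/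
theorem lintegral_sqrt_mul_condRatio_sub_sq_le {n : ℕ} {h : History E n} {z w : ℝ}
    (hz : 0 ≤ z) (hw : 0 ≤ w) (hpq : z ≠ 0 → p n h ≪ q n h) :
    ∫⁻ y, ENNReal.ofReal ((√(z * condRatio p q n (h, y)) - √w) ^ 2) ∂(q n h) ≤
      ENNReal.ofReal ((√z - √w) ^ 2) +
        ENNReal.ofReal z * condHellingerSq p q n h +
        ENNReal.ofReal w * condHellingerSq p q n h := by
  rcases eq_or_ne z 0 with rfl | hz0
  · simp [Real.sq_sqrt hw]
  have hr : ∀ y, 0 ≤ condRatio p q n (h, y) := fun y => condRatio_nonneg _ _ _ _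
  have hrm : Measurable fun y => condRatio p q n (h, y) :=
    (measurable_condRatio p q n).comp measurable_prodMk_left
  have hone : ∫⁻ y, ENNReal.ofReal (condRatio p q n (h, y)) ∂(q n h) = 1 := by
    simpa using lintegral_condRatio_mul p q (hpq hz0) (f := fun _ => 1) measurable_const
  set u := √z
  set v := √w
  have hu : 0 ≤ u := Real.sqrt_nonneg _
  have hv : 0 ≤ v := Real.sqrt_nonneg _
  have hu2 : z = u ^ 2 := (Real.sq_sqrt hz).symm
  have hv2 : w = v ^ 2 := (Real.sq_sqrt hw).symm
  have huv : 0 ≤ u * v := mul_nonneg hu hv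
  -- With `s = √r` and `∫ s² = 1`, this integrates to `∫ (us - v)² = (u - v)² + uv ∫ (s - 1)²`, and
  -- `2uv ≤ z + w` then gives the claim. The cross terms are added to both sides to avoid truncated
  -- subtraction.
  have hpt : ∀ y, ENNReal.ofReal ((√(z * condRatio p q n (h, y)) - v) ^ 2) +
      ENNReal.ofReal (u * v) * (ENNReal.ofReal (condRatio p q n (h, y)) + 1) =
      ENNReal.ofReal (u ^ 2) * ENNReal.ofReal (condRatio p q n (h, y)) + ENNReal.ofReal (v ^ 2) +
      ENNReal.ofReal (u * v) * ENNReal.ofReal ((√(condRatio p q n (h, y)) - 1) ^ 2) := by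
    intro y
    have hs := Real.sq_sqrt (hr y)
    have := mul_sqrt_sub_sq_add u v √(condRatio p q n (h, y))
    rw [hs] at this
    rw [Real.sqrt_mul hz, ← ENNReal.ofReal_one, ← ENNReal.ofReal_add (hr y) zero_le_one,
      ← ENNReal.ofReal_mul huv, ← ENNReal.ofReal_mul (sq_nonneg _), ← ENNReal.ofReal_mul huv,
      ← ENNReal.ofReal_add (by positivity) (mul_nonneg huv (add_nonneg (hr y) zero_le_one)),
      ← ENNReal.ofReal_add (mul_nonneg (sq_nonneg _) (hr y)) (sq_nonneg _),
      ← ENNReal.ofReal_add (add_nonneg (mul_nonneg (sq_nonneg _) (hr y)) (sq_nonneg _))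
        (by positivity), this]
  have hint := lintegral_congr (μ := q n h) hpt
  have hη : ∫⁻ y, ENNReal.ofReal ((√(condRatio p q n (h, y)) - 1) ^ 2) ∂(q n h) =
      2 * condHellingerSq p q n h := by
    rw [condHellingerSq, ← mul_assoc, ENNReal.mul_inv_cancel two_ne_zero ENNReal.ofNat_ne_top,
      one_mul]
  rw [lintegral_add_left (by fun_prop), lintegral_const_mul _ (by fun_prop),
    lintegral_add_right _ measurable_const, hone, lintegral_add_left (by fun_prop),
    lintegral_add_right _ measurable_const, lintegral_const_mul _ (by fun_prop), hone,
    lintegral_const_mul _ (by fun_prop), hη] at hint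
  simp only [lintegral_const, measure_univ, mul_one] at hint
  have hsq : ENNReal.ofReal ((u - v) ^ 2) + ENNReal.ofReal (u * v) * (1 + 1) =
      ENNReal.ofReal (u ^ 2) + ENNReal.ofReal (v ^ 2) := by
    rw [mul_add, mul_one, ← ENNReal.ofReal_add huv huv,
      ← ENNReal.ofReal_add (sq_nonneg _) (by positivity),
      ← ENNReal.ofReal_add (sq_nonneg _) (sq_nonneg _)]
    congr 1
    ring
  rw [← hsq, add_right_comm] at hint
  have hfin : ENNReal.ofReal (u * v) * (1 + 1) ≠ ∞ :=
    ENNReal.mul_ne_top ENNReal.ofReal_ne_top (by norm_num)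
  rw [(ENNReal.add_left_inj hfin).1 hint, hu2, hv2, add_assoc, ← add_mul, ← mul_assoc,
    ← ENNReal.ofReal_add (sq_nonneg _) (sq_nonneg _)]
  gcongr
  rw [mul_comm, ← ENNReal.ofReal_ofNat, ← ENNReal.ofReal_mul zero_le_two]
  refine ENNReal.ofReal_le_ofReal ?_
  nlinarith [sq_nonneg (u - v)]

/-- The event that the squared Hellinger distances of the conditional distributions with indices
in `[m, n)` add up to at most `c`. -/
def smallVariation (c : ℝ≥0∞) (m n : ℕ) : Set ((i : ℕ) → E i) :=
  {x | ∑ i ∈ Finset.Ico m n, condHellingerSq p q i (past i x) ≤ c}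

omit [∀ n, IsMarkovKernel (p n)] in
theorem measurableSet_smallVariation (c : ℝ≥0∞) (m : ℕ) {n j : ℕ} (h : n ≤ j + 1) :
    MeasurableSet[pastAlgebra E j] (smallVariation p q c m n) := by
  have : Measurable[pastAlgebra E j] fun x : (i : ℕ) → E i =>
      ∑ i ∈ Finset.Ico m n, condHellingerSq p q i (past i x) :=
    Finset.measurable_fun_sum _ fun i hi => (measurable_condHellingerSq p q i).comp
      (measurable_past_pastAlgebra (Nat.lt_succ_iff.1 ((Finset.mem_Ico.1 hi).2.trans_le h)))
  exact this measurableSet_Iic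

omit [∀ n, IsMarkovKernel (p n)] [∀ n, IsMarkovKernel (q n)] in
theorem smallVariation_anti (c : ℝ≥0∞) (m : ℕ) {n n' : ℕ} (h : n ≤ n') :
    smallVariation p q c m n' ⊆ smallVariation p q c m n := fun x hx =>
  (Finset.sum_le_sum_of_subset (f := fun i => condHellingerSq p q i (past i x))
    (Finset.Ico_subset_Ico_right h)).trans hx

-- The `i`-th indicator tests the partial sum with the `i`-th term included, so summation stops
-- before `c` is exceeded.
omit [∀ n, IsMarkovKernel (p n)] [∀ n, IsMarkovKernel (q n)] in
theorem sum_indicator_smallVariation_le (c : ℝ≥0∞) {m n : ℕ} (hmn : m ≤ n)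
    (x : (i : ℕ) → E i) :
    ∑ i ∈ Finset.Ico m n, (smallVariation p q c m (i + 1)).indicator
      (fun x => condHellingerSq p q i (past i x)) x ≤ c := by
  induction n, hmn using Nat.le_induction with
  | base => simp
  | succ n hmn ih =>
    by_cases hx : x ∈ smallVariation p q c m (n + 1)
    · exact (Finset.sum_le_sum fun i _ => Set.indicator_le_self _ _ _).trans hx
    · rw [Finset.sum_Ico_succ_top hmn, Set.indicator_of_notMem hx, add_zero]
      exact ih

variable {P Q : Measure ((i : ℕ) → E i)} [IsProbabilityMeasure P] [IsProbabilityMeasure Q]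

/-- The histories where absolute continuity fails are `P`-null, and `P` has density `pastRatio`
there, so the ratio vanishes `Q`-a.e. on them. -/
theorem ae_absolutelyContinuous_of_pastRatio_ne_zero
    (hp : IsPredictive P p) (hq : IsPredictive Q q)
    (hpq : ∀ n, ∀ᵐ x ∂P, p n (past n x) ≪ q n (past n x)) (n : ℕ) :
    ∀ᵐ x ∂Q, pastRatio p q n x ≠ 0 → p n (past n x) ≪ q n (past n x) := by
  have hS : MeasurableSet[pastAlgebra E n] {x : (i : ℕ) → E i | p n (past n x) ≪ q n (past n x)} :=
    ⟨_, Kernel.measurableSet_absolutelyContinuous (p n) (q n), rfl⟩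
  have h := lintegral_eq_lintegral_mul_pastRatio p q hp hq hpq n
    (f := {x | p n (past n x) ≪ q n (past n x)}ᶜ.indicator 1)
    ((@measurable_const _ _ _ (pastAlgebra E n) 1).indicator hS.compl)
  rw [lintegral_indicator_one (pastAlgebra_le n _ hS.compl), show P _ = 0 from hpq n, eq_comm,
    lintegral_eq_zero_iff] at h
  · filter_upwards [h] with x hx h0
    by_contra hn
    simp [Set.indicator, hn] at hx
    exact h0 (le_antisymm hx (pastRatio_nonneg p q n x))
  · exact ((measurable_one.indicator (pastAlgebra_le n _ hS.compl))).mul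
      ((measurable_pastRatio p q n).mono (pastAlgebra_le n) le_rfl).ennreal_ofReal

/-- The event up to index `n + 1` depends only on the first `n` terms, so it factors out when `x n`
is integrated under `q n`. -/
theorem lintegral_smallVariation_succ_le
    (hp : IsPredictive P p) (hq : IsPredictive Q q)
    (hpq : ∀ n, ∀ᵐ x ∂P, p n (past n x) ≪ q n (past n x)) (c : ℝ≥0∞) {m n : ℕ} (hmn : m ≤ n) :
    ∫⁻ x in smallVariation p q c m (n + 1),
        ENNReal.ofReal ((√(pastRatio p q (n + 1) x) - √(pastRatio p q m x)) ^ 2) ∂Q ≤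
      ∫⁻ x in smallVariation p q c m (n + 1),
        (ENNReal.ofReal ((√(pastRatio p q n x) - √(pastRatio p q m x)) ^ 2) +
          ENNReal.ofReal (pastRatio p q n x) * condHellingerSq p q n (past n x) +
          ENNReal.ofReal (pastRatio p q m x) * condHellingerSq p q n (past n x)) ∂Q := by
  obtain ⟨B, hB, hBeq⟩ := measurableSet_smallVariation p q c m (n := n + 1) le_rfl
  obtain ⟨z, hz, hzeq⟩ := (measurable_pastRatio p q n).exists_eq_measurable_comp
  obtain ⟨w, hw, hweq⟩ := ((measurable_pastRatio p q m).mono (pastAlgebra_mono hmn)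
    le_rfl).exists_eq_measurable_comp
  have hzx : ∀ x, pastRatio p q n x = z (past n x) := fun x => congrFun hzeq x
  have hwx : ∀ x, pastRatio p q m x = w (past n x) := fun x => congrFun hweq x
  have hBm : MeasurableSet (smallVariation p q c m (n + 1)) :=
    pastAlgebra_le n _ (measurableSet_smallVariation p q c m le_rfl)
  rw [← lintegral_indicator hBm, ← lintegral_indicator hBm]
  have h := hq.lintegral_next n (g := fun a => B.indicator 1 a.1 *
    ENNReal.ofReal ((√(z a.1 * condRatio p q n a) - √(w a.1)) ^ 2)) (by
      have := measurable_condRatio p q n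
      exact ((measurable_one.indicator hB).comp measurable_fst).mul (by fun_prop))
  trans ∫⁻ x, B.indicator 1 (past n x) * ENNReal.ofReal
    ((√(z (past n x) * condRatio p q n (past n x, x n)) - √(w (past n x))) ^ 2) ∂Q
  · refine le_of_eq (lintegral_congr fun x => ?_)
    rw [← hBeq]
    by_cases hx : past n x ∈ B <;> simp [Set.indicator, hx, pastRatio_succ, hzx, hwx]
  rw [h]
  refine lintegral_mono_ae ?_
  filter_upwards [ae_absolutelyContinuous_of_pastRatio_ne_zero p q hp hq hpq n] with x hx
  have hz0 := pastRatio_nonneg p q n x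
  have hw0 := pastRatio_nonneg p q m x
  rw [hzx] at hx hz0
  rw [hwx] at hw0
  rw [← hBeq]
  by_cases hxB : past n x ∈ B
  · simpa [Set.indicator, hxB, hzx, hwx] using
      lintegral_sqrt_mul_condRatio_sub_sq_le p q hz0 hw0 hx
  · simp [Set.indicator, hxB]

theorem lintegral_ofReal_pastRatio (hp : IsPredictive P p) (hq : IsPredictive Q q)
    (hpq : ∀ n, ∀ᵐ x ∂P, p n (past n x) ≪ q n (past n x)) (n : ℕ) :
    ∫⁻ x, ENNReal.ofReal (pastRatio p q n x) ∂Q = 1 := by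
  simpa using (lintegral_eq_lintegral_mul_pastRatio p q hp hq hpq n (f := 1)
    (@measurable_const _ _ _ (pastAlgebra E n) 1)).symm

theorem lintegral_smallVariation_le
    (hp : IsPredictive P p) (hq : IsPredictive Q q)
    (hpq : ∀ n, ∀ᵐ x ∂P, p n (past n x) ≪ q n (past n x)) (c : ℝ≥0∞) {m n : ℕ} (hmn : m ≤ n) :
    ∫⁻ x in smallVariation p q c m n,
        ENNReal.ofReal ((√(pastRatio p q n x) - √(pastRatio p q m x)) ^ 2) ∂Q ≤ 2 * c := by
  have hZ : ∀ n, Measurable (pastRatio p q n) := fun n =>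
    (measurable_pastRatio p q n).mono (pastAlgebra_le n) le_rfl
  have hη : ∀ i, Measurable[pastAlgebra E i] ((smallVariation p q c m (i + 1)).indicator
      (fun x => condHellingerSq p q i (past i x))) := fun i =>
    Measurable.indicator (m := pastAlgebra E i) (f := fun x => condHellingerSq p q i (past i x))
      ((measurable_condHellingerSq p q i).comp (comap_measurable (past i)))
      (measurableSet_smallVariation p q c m le_rfl)
  have hη' : ∀ i, Measurable ((smallVariation p q c m (i + 1)).indicator
      (fun x => condHellingerSq p q i (past i x))) := fun i =>
    (hη i).mono (pastAlgebra_le i) le_rfl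
  have step : ∫⁻ x in smallVariation p q c m n,
        ENNReal.ofReal ((√(pastRatio p q n x) - √(pastRatio p q m x)) ^ 2) ∂Q ≤
      ∑ i ∈ Finset.Ico m n, (∫⁻ x, (smallVariation p q c m (i + 1)).indicator
          (fun x => condHellingerSq p q i (past i x)) x * ENNReal.ofReal (pastRatio p q i x) ∂Q +
        ∫⁻ x, (smallVariation p q c m (i + 1)).indicator
          (fun x => condHellingerSq p q i (past i x)) x *
            ENNReal.ofReal (pastRatio p q m x) ∂Q) := by
    induction n, hmn using Nat.le_induction with
    | base => simp
    | succ n hmn ih =>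
      have hB : MeasurableSet (smallVariation p q c m (n + 1)) :=
        pastAlgebra_le n _ (measurableSet_smallVariation p q c m le_rfl)
      have hZη : ∀ j, Measurable fun x =>
          ENNReal.ofReal (pastRatio p q j x) * condHellingerSq p q n (past n x) := fun j =>
        (hZ j).ennreal_ofReal.mul
          ((measurable_condHellingerSq p q n).comp (measurable_past n))
      refine (lintegral_smallVariation_succ_le p q hp hq hpq c hmn).trans ?_
      rw [Finset.sum_Ico_succ_top hmn,
        lintegral_add_right _ (hZη m),
        lintegral_add_right _ (hZη n), add_assoc]
      -- The events shrink with `n`, so the previous square may be integrated over the larger event.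
      refine add_le_add ((lintegral_mono_set
        (smallVariation_anti p q c m n.le_succ)).trans ih) (le_of_eq ?_)
      rw [← lintegral_indicator hB, ← lintegral_indicator hB]
      congr 1 <;> refine lintegral_congr fun x => ?_ <;>
      by_cases hx : x ∈ smallVariation p q c m (n + 1) <;> simp [Set.indicator, hx, mul_comm]
  refine step.trans ?_
  rw [Finset.sum_add_distrib, two_mul]
  refine add_le_add ?_ ?_
  -- The weight `Z_i` varies with `i`, but it turns each integral into one under `P`, where the
  -- stopped sum is at most `c`. The other sum has the fixed weight `Z_m`, of `Q`-integral 1.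
  · simp_rw [← fun i => lintegral_eq_lintegral_mul_pastRatio p q hp hq hpq i (hη i)]
    rw [← lintegral_finsetSum _ fun i _ => hη' i]
    refine (lintegral_mono fun x => sum_indicator_smallVariation_le p q c hmn x).trans ?_
    simp
  · have hηZ : ∀ i, Measurable fun x => (smallVariation p q c m (i + 1)).indicator
        (fun x => condHellingerSq p q i (past i x)) x * ENNReal.ofReal (pastRatio p q m x) :=
      fun i => (hη' i).mul (hZ m).ennreal_ofReal
    rw [← lintegral_finsetSum _ fun i _ => hηZ i]
    simp_rw [← Finset.sum_mul]
    refine (lintegral_mono fun x => mul_le_mul_left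
      (sum_indicator_smallVariation_le p q c hmn x) _).trans ?_
    rw [lintegral_const_mul _ (hZ m).ennreal_ofReal,
      lintegral_ofReal_pastRatio p q hp hq hpq m, mul_one]

/-- Factor `z - w = (√z - √w)(√z + √w)` and apply the weighted arithmetic-geometric mean inequality.
-/
theorem pastRatio_sub_le {z w t : ℝ} (hz : 0 ≤ z) (hw : 0 ≤ w) (ht : 0 < t) :
    z ≤ w + t⁻¹ * (√z - √w) ^ 2 + t * (z + w) := by
  set u := √z
  set v := √w
  have hu2 : z = u ^ 2 := (Real.sq_sqrt hz).symm
  have hv2 : w = v ^ 2 := (Real.sq_sqrt hw).symm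
  rw [hu2, hv2]
  have h : (u - v) * (u + v) ≤ t⁻¹ * (u - v) ^ 2 + t * (u ^ 2 + v ^ 2) := by
    have h1 : 0 ≤ t⁻¹ * ((u - v) - t * (u + v) / 2) ^ 2 := by positivity
    have h2 : t⁻¹ * ((u - v) - t * (u + v) / 2) ^ 2 =
        t⁻¹ * (u - v) ^ 2 - (u - v) * (u + v) + t * (u + v) ^ 2 / 4 := by
      field_simp
      ring
    nlinarith [mul_nonneg ht.le (sq_nonneg (u - v)), mul_nonneg ht.le (sq_nonneg (u + v)),
      mul_nonneg ht.le (sq_nonneg u), mul_nonneg ht.le (sq_nonneg v)]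
  nlinarith

/-- On the event that the Hellinger variation after time `m` is small, `P` is close to the measure
that continues `P` after time `m` like `Q`. -/
theorem measure_inter_smallVariation_le
    (hp : IsPredictive P p) (hq : IsPredictive Q q)
    (hpq : ∀ n, ∀ᵐ x ∂P, p n (past n x) ≪ q n (past n x)) {t : ℝ} (ht : 0 < t)
    {m n : ℕ} (hmn : m ≤ n) {A : Set ((i : ℕ) → E i)} (hA : MeasurableSet[pastAlgebra E n] A) :
    P (A ∩ smallVariation p q (ENNReal.ofReal (t ^ 2)) m n) ≤
      ∫⁻ x in A, ENNReal.ofReal (pastRatio p q m x) ∂Q + ENNReal.ofReal (4 * t) := by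
  have hZ : ∀ n, Measurable (pastRatio p q n) := fun n =>
    (measurable_pastRatio p q n).mono (pastAlgebra_le n) le_rfl
  set B := smallVariation p q (ENNReal.ofReal (t ^ 2)) m n
  have hB : MeasurableSet[pastAlgebra E n] B :=
    measurableSet_smallVariation p q _ m n.le_succ
  have hAB : MeasurableSet[pastAlgebra E n] (A ∩ B) := hA.inter hB
  have hAB' := pastAlgebra_le n _ hAB
  have h := lintegral_eq_lintegral_mul_pastRatio p q hp hq hpq n
    (f := (A ∩ B).indicator 1)
    ((@measurable_const _ _ _ (pastAlgebra E n) 1).indicator hAB)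
  rw [lintegral_indicator_one hAB'] at h
  have hpt : ∀ x, ENNReal.ofReal (pastRatio p q n x) ≤ ENNReal.ofReal (pastRatio p q m x) +
      ENNReal.ofReal t⁻¹ *
        ENNReal.ofReal ((√(pastRatio p q n x) - √(pastRatio p q m x)) ^ 2) +
      ENNReal.ofReal t *
        (ENNReal.ofReal (pastRatio p q n x) + ENNReal.ofReal (pastRatio p q m x)) := by
    intro x
    have hn := pastRatio_nonneg p q n x
    have hm := pastRatio_nonneg p q m x
    rw [← ENNReal.ofReal_add hn hm, ← ENNReal.ofReal_mul (inv_pos.2 ht).le,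
      ← ENNReal.ofReal_mul ht.le, ← ENNReal.ofReal_add hm (by positivity),
      ← ENNReal.ofReal_add (by positivity) (by positivity)]
    exact ENNReal.ofReal_le_ofReal (pastRatio_sub_le hn hm ht)
  calc P (A ∩ B) = ∫⁻ x in A ∩ B, ENNReal.ofReal (pastRatio p q n x) ∂Q := by
        rw [h, ← lintegral_indicator hAB']
        refine lintegral_congr fun x => ?_
        by_cases hx : x ∈ A ∩ B <;> simp only [Set.indicator, hx, if_true, if_false] <;> simp
    _ ≤ ∫⁻ x in A ∩ B, (ENNReal.ofReal (pastRatio p q m x) +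
          ENNReal.ofReal t⁻¹ *
            ENNReal.ofReal ((√(pastRatio p q n x) - √(pastRatio p q m x)) ^ 2) +
          ENNReal.ofReal t *
            (ENNReal.ofReal (pastRatio p q n x) + ENNReal.ofReal (pastRatio p q m x))) ∂Q :=
        lintegral_mono hpt
    _ = ∫⁻ x in A ∩ B, ENNReal.ofReal (pastRatio p q m x) ∂Q +
          ENNReal.ofReal t⁻¹ * ∫⁻ x in A ∩ B,
            ENNReal.ofReal ((√(pastRatio p q n x) - √(pastRatio p q m x)) ^ 2) ∂Q +
          ENNReal.ofReal t * (∫⁻ x in A ∩ B, ENNReal.ofReal (pastRatio p q n x) ∂Q +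
            ∫⁻ x in A ∩ B, ENNReal.ofReal (pastRatio p q m x) ∂Q) := by
        have h1 := hZ n
        have h2 := hZ m
        rw [lintegral_add_right _ (by fun_prop), lintegral_add_right _ (by fun_prop),
          lintegral_const_mul _ (by fun_prop), lintegral_const_mul _ (by fun_prop),
          lintegral_add_right _ (by fun_prop)]
    -- The bound `c = t²` balances the errors: `t⁻¹ · 2t²` and `t · (1 + 1)` are both `2t`.
    _ ≤ ∫⁻ x in A, ENNReal.ofReal (pastRatio p q m x) ∂Q +
          ENNReal.ofReal t⁻¹ * (2 * ENNReal.ofReal (t ^ 2)) + ENNReal.ofReal t * (1 + 1) := by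
        gcongr
        · exact Set.inter_subset_left
        · exact (lintegral_mono_set Set.inter_subset_right).trans
            (lintegral_smallVariation_le p q hp hq hpq _ hmn)
        · exact (setLIntegral_le_lintegral _ _).trans
            (lintegral_ofReal_pastRatio p q hp hq hpq n).le
        · exact (setLIntegral_le_lintegral _ _).trans
            (lintegral_ofReal_pastRatio p q hp hq hpq m).le
    _ = _ := by
        rw [add_assoc]
        congr 1
        rw [one_add_one_eq_two, ← ENNReal.ofReal_ofNat 2, ← ENNReal.ofReal_mul two_pos.le,
          ← ENNReal.ofReal_mul (inv_pos.2 ht).le, ← ENNReal.ofReal_mul ht.le,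
          ← ENNReal.ofReal_add (by positivity) (by positivity)]
        congr 1
        field_simp
        ring

end Hellinger

/-! ### Singularity and divergence of the Hellinger sum -/

section Kakutani

variable {E : ℕ → Type*} [∀ i, MeasurableSpace (E i)]

theorem exists_measurableSet_pastAlgebra_of_mem_measurableCylinders
    {A : Set ((i : ℕ) → E i)} (hA : A ∈ measurableCylinders E) :
    ∃ N, ∀ n, N ≤ n → MeasurableSet[pastAlgebra E n] A := by
  obtain ⟨s, S, hS, rfl⟩ := (mem_measurableCylinders A).1 hA
  refine ⟨s.sup id + 1, fun n hn => ?_⟩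
  have : Measurable[pastAlgebra E n] (s.restrict : ((i : ℕ) → E i) → _) :=
    @measurable_pi_lambda _ _ _ (pastAlgebra E n) _ _ fun i =>
      measurable_apply_pastAlgebra
        ((Nat.lt_succ_of_le (Finset.le_sup (f := id) i.2)).trans_le hn)
  exact this hS

variable [∀ i, MeasurableSpace.CountablyGenerated (E i)]
  (p q : (n : ℕ) → Kernel (History E n) (E n))
  [∀ n, IsMarkovKernel (p n)] [∀ n, IsMarkovKernel (q n)]
  {P Q : Measure ((i : ℕ) → E i)} [IsProbabilityMeasure P] [IsProbabilityMeasure Q]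

theorem measure_iInter_smallVariation_le
    (hp : IsPredictive P p) (hq : IsPredictive Q q)
    (hpq : ∀ n, ∀ᵐ x ∂P, p n (past n x) ≪ q n (past n x)) (hsing : P ⟂ₘ Q)
    {t : ℝ} (ht : 0 < t) (m : ℕ) :
    P (⋂ n, smallVariation p q (ENNReal.ofReal (t ^ 2)) m n) ≤ ENNReal.ofReal (6 * t) := by
  obtain ⟨S, hS, hPS, hQS⟩ := hsing
  set R := Q.withDensity fun x => ENNReal.ofReal (pastRatio p q m x)
  have : IsFiniteMeasure R := isFiniteMeasure_withDensity (by
    rw [lintegral_ofReal_pastRatio p q hp hq hpq m]; exact ENNReal.one_ne_top)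
  have hRS : R Sᶜ = 0 := withDensity_absolutelyContinuous _ _ hQS
  -- `P` lives on `Sᶜ`, which is null for `R`. Approximation with respect to `P + R` yields one
  -- cylinder good for both measures.
  obtain ⟨A, hA, hSA⟩ := (Measure.MeasureDense.of_generateFrom_isSetAlgebra_finite (P + R)
    isSetAlgebra_measurableCylinders generateFrom_measurableCylinders.symm).approx Sᶜ hS.compl
    (measure_ne_top _ _) t ht
  obtain ⟨N, hN⟩ := exists_measurableSet_pastAlgebra_of_mem_measurableCylinders hA
  set n := max N m
  have hAn := hN n (le_max_left _ _)
  have hP : P (Sᶜ \ A) ≤ ENNReal.ofReal t :=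
    ((measure_mono fun x hx => Or.inl hx).trans
      (Measure.le_add_right le_rfl _)).trans hSA.le
  have hR : R A ≤ ENNReal.ofReal t := by
    calc R A ≤ R (Sᶜ ∪ symmDiff Sᶜ A) := measure_mono fun x hx => by
          by_cases h : x ∈ Sᶜ
          · exact Or.inl h
          · exact Or.inr (Or.inr ⟨hx, h⟩)
      _ ≤ R Sᶜ + R (symmDiff Sᶜ A) := measure_union_le _ _
      _ ≤ ENNReal.ofReal t := by
          rw [hRS, zero_add]
          exact (Measure.le_add_left le_rfl _).trans hSA.le
  calc P (⋂ n, smallVariation p q (ENNReal.ofReal (t ^ 2)) m n)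
      ≤ P (S ∪ (Sᶜ \ A) ∪ (A ∩ smallVariation p q (ENNReal.ofReal (t ^ 2)) m n)) :=
        measure_mono fun x hx => by
          by_cases h : x ∈ S
          · exact Or.inl (Or.inl h)
          by_cases h' : x ∈ A
          · exact Or.inr ⟨h', Set.mem_iInter.1 hx n⟩
          · exact Or.inl (Or.inr ⟨h, h'⟩)
    _ ≤ P S + P (Sᶜ \ A) + P (A ∩ smallVariation p q (ENNReal.ofReal (t ^ 2)) m n) :=
        (measure_union_le _ _).trans (add_le_add (measure_union_le _ _) le_rfl)
    -- One `t` for the part of `Sᶜ` missed by `A`, one for `R A`, and `4t` from the Hellinger bound.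
    _ ≤ 0 + ENNReal.ofReal t + (ENNReal.ofReal t + ENNReal.ofReal (4 * t)) := by
        refine add_le_add (add_le_add hPS.le hP) ?_
        refine (measure_inter_smallVariation_le p q hp hq hpq ht (le_max_right N m) hAn).trans ?_
        rw [← withDensity_apply _ (pastAlgebra_le n _ hAn)]
        exact add_le_add hR le_rfl
    _ = _ := by
        rw [zero_add, ← ENNReal.ofReal_add ht.le (by positivity),
          ← ENNReal.ofReal_add ht.le (by positivity)]
        congr 1
        ring

/-- The predictive criterion for singularity: if `P` and `Q` are mutually singular, then the
squared Hellinger distances of the conditional distributions have an infinite sum `P`-a.s. -/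
theorem ae_tsum_condHellingerSq_eq_top
    (hp : IsPredictive P p) (hq : IsPredictive Q q)
    (hpq : ∀ n, ∀ᵐ x ∂P, p n (past n x) ≪ q n (past n x)) (hsing : P ⟂ₘ Q) :
    ∀ᵐ x ∂P, ∑' i, condHellingerSq p q i (past i x) = ∞ := by
  have hle : ∀ t : ℝ, 0 < t →
      P {x | ¬ ∑' i, condHellingerSq p q i (past i x) = ∞} ≤ ENNReal.ofReal (6 * t) := by
    intro t ht
    have hsub : {x | ¬ ∑' i, condHellingerSq p q i (past i x) = ∞} ⊆
        ⋃ m, ⋂ n, smallVariation p q (ENNReal.ofReal (t ^ 2)) m n := by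
      intro x hx
      set f : ℕ → ℝ≥0∞ := fun i => condHellingerSq p q i (past i x)
      -- The tails of a finite sum tend to zero, so some tail is at most `t²`.
      have h := ENNReal.tendsto_sum_nat_add f hx
      obtain ⟨m, hm⟩ := (h.eventually_le_const
        (show 0 < ENNReal.ofReal (t ^ 2) by positivity)).exists
      refine Set.mem_iUnion.2 ⟨m, Set.mem_iInter.2 fun n => le_trans ?_ hm⟩
      change ∑ i ∈ Finset.Ico m n, f i ≤ _
      rw [Finset.sum_Ico_eq_sum_range]
      simp_rw [add_comm m]
      exact ENNReal.sum_le_tsum _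
    have hmono : Monotone fun m => ⋂ n, smallVariation p q (ENNReal.ofReal (t ^ 2)) m n :=
      fun m m' h => Set.iInter_mono fun n x hx =>
        (Finset.sum_le_sum_of_subset (f := fun i => condHellingerSq p q i (past i x))
          (Finset.Ico_subset_Ico_left h)).trans hx
    refine (measure_mono hsub).trans ?_
    rw [hmono.measure_iUnion]
    exact iSup_le fun m => measure_iInter_smallVariation_le p q hp hq hpq hsing ht m
  refine le_antisymm (ENNReal.le_of_forall_pos_le_add fun ε hε _ => ?_) zero_le
  refine (hle (ε / 6) (by positivity)).trans (le_of_eq ?_)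
  rw [mul_div_cancel₀ _ (by norm_num), zero_add, ENNReal.ofReal_coe_nnreal]

end Kakutani

/-! ### From Hellinger distances to discrepancies -/

theorem lemma1 {E : ℕ → Type*} [∀ i, MeasurableSpace (E i)]
    [∀ i, MeasurableSpace.CountablyGenerated (E i)]
    (P Q : Measure ((i : ℕ) → E i)) [IsProbabilityMeasure P] [IsProbabilityMeasure Q]
    (p q : (n : ℕ) → Kernel (History E n) (E n))
    [∀ n, IsMarkovKernel (p n)] [∀ n, IsMarkovKernel (q n)]
    (hp : IsPredictive P p) (hq : IsPredictive Q q)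
    (hac : ∀ n, jointLaw P n ≪ jointLaw Q n)
    (S : (n : ℕ) → History E n → ProperScoringRule (E n))
    (hdom : ∀ n, ∀ᵐ x ∂P,
      p n (past n x) ∈ (S n (past n x)).dom ∧ q n (past n x) ∈ (S n (past n x)).dom)
    (hsing : P ⟂ₘ Q)
    (k : ℝ) (hk : 0 < k)
    (hdisc : ∀ n, ∀ᵐ x ∂P,
      ((k * hellingerDist (p n (past n x)) (q n (past n x)) ^ 2 : ℝ) : EReal) ≤
        (S n (past n x)).discrepancy (p n (past n x)) (q n (past n x))) :
    ∀ᵐ x ∂P, Tendsto (fun n => cumulativeDiscrepancy S p q n x) atTop (𝓝 ⊤) := by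
  have hpq := ae_absolutelyContinuous_predictive hp hq hac
  filter_upwards [ae_tsum_condHellingerSq_eq_top p q hp hq hpq hsing, ae_all_iff.2 hpq,
    ae_all_iff.2 hdisc] with x hsum hx hd
  set H : ℕ → ℝ := fun n => hellingerDist (p n (past n x)) (q n (past n x)) ^ 2
  have hH : ∀ n, 0 ≤ H n := fun n => sq_nonneg _
  have hsum' : ∑' n, ENNReal.ofReal (H n) = ∞ := by
    rw [← hsum]
    exact tsum_congr fun n => (condHellingerSq_eq p q (hx n)).symm
  have hnot : ¬ Summable H := fun h => by
    rw [← ENNReal.ofReal_tsum_of_nonneg hH h] at hsum'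
    exact ENNReal.ofReal_ne_top hsum'
  have hreal : Tendsto (fun n => k * ∑ i ∈ Finset.range n, H i) atTop atTop :=
    ((not_summable_iff_tendsto_nat_atTop_of_nonneg hH).1 hnot).const_mul_atTop hk
  have hE : Tendsto (fun n => ((k * ∑ i ∈ Finset.range n, H i : ℝ) : EReal)) atTop (𝓝 ⊤) :=
    EReal.tendsto_coe_nhds_top_iff.2 hreal
  refine tendsto_nhds_top_mono' hE fun n => ?_
  change _ ≤ ∑ i ∈ Finset.range n, _
  -- The coercion to `EReal` is additive, so the comparison can be made term by term.
  rw [Finset.mul_sum, show ((∑ i ∈ Finset.range n, k * H i : ℝ) : EReal) =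
    ∑ i ∈ Finset.range n, ((k * H i : ℝ) : EReal) from
    map_sum (⟨⟨Real.toEReal, EReal.coe_zero⟩, EReal.coe_add⟩ : ℝ →+ EReal) _ _]
  exact Finset.sum_le_sum fun i _ => hd i
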